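/- Let $\Gamma$ denote the Gamma function, and let $\Gamma^{(n)}$ denote its $n$-th derivative. For every integer $n \ge 2$, $$\#\{\, m \in \mathbb{Z}_{\ge 1} : \Gamma^{(n)}(m) \text{ is algebraic over } \mathbb{Q} \,\} \le n-1 .$$ In particular, this set is finite. -/

import Mathlib

/-! Write γ_k = Γ^{(k)}(1)/k!. Since Γ(m+1+s)/m! = Γ(1+s)·∏_{k≤m}(1+s/k), the number
Γ^{(n)}(m+1)/(n! m!) is a combination of γ_n, …, γ_0 = 1 with rational coefficients e_j(1, 1/2, …,
1/m) (`normalizedTaylorCoeff_eq_sum`). For n distinct values of m the n×n matrix with columns j < n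
is invertible (`isUnit_det_esymmInv`), so n algebraic values would make γ_1 and γ_2 algebraic. But
the reflection formula gives 12γ_2 − 6γ_1² = π² (`iteratedDeriv_two_Gamma_one`), and π is
transcendental by Lindemann's argument. -/

/-! ### Transcendence of π -/

open Polynomial in
theorem isIntegral_pow_mul_aeval {K : Type*} [Field K] {l : ℤ} {b : K} (h : IsIntegral ℤ ((l : K) * b))
    (g : ℤ[X]) {M : ℕ} (hM : g.natDegree ≤ M) : IsIntegral ℤ ((l : K) ^ M * aeval b g) := by
  rw [aeval_eq_sum_range' (Nat.lt_succ_of_le hM), Finset.mul_sum]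
  refine IsIntegral.sum _ fun i hi => ?_
  have hi' : i ≤ M := Nat.lt_succ_iff.mp (Finset.mem_range.mp hi)
  have e : (l : K) ^ M * (g.coeff i • b ^ i) =
      ((g.coeff i * l ^ (M - i) : ℤ) : K) * ((l : K) * b) ^ i := by
    obtain ⟨d, rfl⟩ := Nat.exists_eq_add_of_le hi'
    simp only [zsmul_eq_mul, Nat.add_sub_cancel_left]
    push_cast
    ring
  rw [e]
  exact (isIntegral_algebraMap (R := ℤ) (A := K)).mul (h.pow i)

theorem exists_intCast_eq_of_isIntegral_of_fixed {K : Type*} [Field K] [CharZero K] [Algebra ℚ K]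
    [IsGalois ℚ K] {x : K} (hx : IsIntegral ℤ x) (hf : ∀ σ : K ≃ₐ[ℚ] K, σ x = x) :
    ∃ N : ℤ, x = N := by
  obtain ⟨q, rfl⟩ := (InfiniteGalois.mem_range_algebraMap_iff_fixed (k := ℚ) x).mpr hf
  have hq : IsIntegral ℤ q :=
    (isIntegral_algebraMap_iff (R := ℤ) (algebraMap ℚ K).injective).mp hx
  obtain ⟨N, rfl⟩ := IsIntegrallyClosed.isIntegral_iff.mp hq
  exact ⟨N, by simp⟩

open Polynomial in
/-- A Galois stable multiset of nonzero algebraic numbers is the zero set of an integer polynomial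
with nonzero constant term. -/
theorem exists_int_polynomial_of_fixed {K : Type*} [Field K] [CharZero K] [Algebra ℚ K]
    [IsGalois ℚ K] {T : Multiset K} (hT : ∀ σ : K ≃ₐ[ℚ] K, T.map σ = T) (h0 : (0 : K) ∉ T) :
    ∃ f : ℤ[X], f.eval 0 ≠ 0 ∧ ∀ b ∈ T, aeval b f = 0 := by
  set Q : K[X] := (T.map fun b => X - C b).prod with hQ
  have hlift : Q ∈ lifts (algebraMap ℚ K) := by
    rw [lifts_iff_coeff_lifts]
    intro n
    refine (InfiniteGalois.mem_range_algebraMap_iff_fixed (k := ℚ) _).mpr fun σ => ?_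
    have : Q.map (σ : K →+* K) = Q := by
      rw [hQ, Polynomial.map_multiset_prod, Multiset.map_map]
      conv_rhs => rw [← hT σ, Multiset.map_map]
      simp
    conv_rhs => rw [← this, coeff_map]
    rfl
  obtain ⟨q, hq⟩ := hlift
  replace hq : q.map (algebraMap ℚ K) = Q := hq
  obtain ⟨a, ha', ha⟩ := IsLocalization.integerNormalization_spec (nonZeroDivisors ℤ) q
  set f := IsLocalization.integerNormalization (nonZeroDivisors ℤ) q
  have ha0 : (a : K) ≠ 0 := Int.cast_ne_zero.mpr (nonZeroDivisors.ne_zero ha')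
  have hmap : f.map (algebraMap ℤ K) = (a : K) • Q := by
    rw [← hq, IsScalarTower.algebraMap_eq ℤ ℚ K, ← Polynomial.map_map, ha]
    ext n
    simp
  have hev : ∀ b : K, aeval b f = a * (T.map fun c => b - c).prod := by
    intro b
    rw [aeval_def, ← eval_map, hmap, eval_smul, hQ, eval_multiset_prod, Multiset.map_map]
    simp
  refine ⟨f, fun h => ?_, fun b hb => ?_⟩
  · have h1 := hev 0
    rw [show (0 : K) = algebraMap ℤ K 0 by simp, aeval_algebraMap_apply] at h1
    simp only [coe_aeval_eq_eval, h, map_zero] at h1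
    rcases mul_eq_zero.mp h1.symm with h2 | h2
    · exact ha0 h2
    · rw [Multiset.prod_eq_zero_iff, Multiset.mem_map] at h2
      obtain ⟨c, hc, hc0⟩ := h2
      rw [zero_sub, neg_eq_zero] at hc0
      exact h0 (hc0 ▸ hc)
  · rw [hev, Multiset.prod_eq_zero (Multiset.mem_map.mpr ⟨b, hb, sub_self b⟩), mul_zero]

open Filter Topology in
theorem tendsto_pow_div_pred_factorial (C : ℝ) :
    Tendsto (fun p : ℕ => C ^ p / (p - 1).factorial) atTop (𝓝 0) := by
  rw [← tendsto_add_atTop_iff_nat 1]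
  have := (FloorSemiring.tendsto_pow_div_factorial_atTop C).const_mul C
  rw [mul_zero] at this
  refine this.congr fun p => ?_
  rw [Nat.add_sub_cancel, pow_succ]
  ring

-- Hermite's argument: for a large prime p, all exp(b) are approximated by p·g(b)/n with p ∤ n.
-- Multiplying a vanishing sum by n·l^(pD) gives an integer congruent to l^(pD)·n·k mod p, hence
-- nonzero, yet of absolute value below 1.
open Polynomial Filter Topology in
theorem intCast_add_sum_exp_ne_zero {K : Type*} [Field K] [CharZero K] [Algebra ℚ K]
    [IsGalois ℚ K] (φ : K →+* ℂ) {T : Multiset K} (hT : ∀ σ : K ≃ₐ[ℚ] K, T.map σ = T)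
    (h0 : (0 : K) ∉ T) {k : ℤ} (hk : k ≠ 0) :
    (k : ℂ) + (T.map fun b => Complex.exp (φ b)).sum ≠ 0 := by
  intro hsum
  obtain ⟨f, hf0, hfT⟩ := exists_int_polynomial_of_fixed hT h0
  have hfne : f ≠ 0 := by rintro rfl; simp at hf0
  obtain ⟨c, hc⟩ := LindemannWeierstrass.exp_polynomial_approx f hf0
  set l := f.leadingCoeff with hl
  have hlne : l ≠ 0 := leadingCoeff_ne_zero.mpr hfne
  set D := f.natDegree
  have hlim : Tendsto (fun p : ℕ => (T.card : ℝ) *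
      ((|(l : ℝ)| ^ D * c) ^ p / (p - 1).factorial)) atTop (𝓝 0) := by
    simpa using (tendsto_pow_div_pred_factorial (|(l : ℝ)| ^ D * c)).const_mul (T.card : ℝ)
  obtain ⟨p, hp, hpl, hpk, hpf, hprime⟩ := ((((hlim.eventually_lt_const one_pos).and
    ((eventually_gt_atTop l.natAbs).and ((eventually_gt_atTop k.natAbs).and
      (eventually_gt_atTop (eval 0 f).natAbs)))).and_frequently
        (Nat.frequently_atTop_iff_infinite.mpr Nat.infinite_setOfPred_prime)).exists.imp fun p h => by
          simpa only [and_assoc] using h)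
  obtain ⟨n, hn, g, hg, hgr⟩ := hc p hpf hprime
  have hint : IsIntegral ℤ ((l : K) ^ (p * D) * (T.map fun b => aeval b g).sum) := by
    rw [← Multiset.sum_map_mul_left]
    refine IsIntegral.multiset_sum fun x hx => ?_
    obtain ⟨b, hb, rfl⟩ := Multiset.mem_map.mp hx
    refine isIntegral_pow_mul_aeval ?_ g (hg.trans (Nat.sub_le _ _))
    have := isIntegral_leadingCoeff_smul f b (hfT b hb)
    rwa [zsmul_eq_mul] at this
  -- Galois stability of `T` makes this algebraic integer rational.
  obtain ⟨N, hN⟩ := exists_intCast_eq_of_isIntegral_of_fixed hint fun σ => by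
    rw [map_mul, map_pow, map_intCast, map_multiset_sum, Multiset.map_map]
    congr 2
    conv_rhs => rw [← hT σ, Multiset.map_map]
    refine Multiset.map_congr rfl fun b _ => ?_
    exact (aeval_algHom_apply (σ.toAlgHom.restrictScalars ℤ) b g).symm
  have hN' : (l : ℂ) ^ (p * D) * (T.map fun b => aeval (φ b) g).sum = N := by
    have := congrArg φ hN
    rw [map_mul, map_pow, map_intCast, map_intCast, map_multiset_sum, Multiset.map_map] at this
    rw [← this]
    congr 2
    refine Multiset.map_congr rfl fun b _ => ?_
    exact aeval_algHom_apply φ.toIntAlgHom b g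
  set err := (T.map fun b => n • Complex.exp (φ b) - p • aeval (φ b) g).sum with herr
  have hid : ((l ^ (p * D) * n * k + p * N : ℤ) : ℂ) = -((l : ℂ) ^ (p * D) * err) := by
    have e1 : err = n * (T.map fun b => Complex.exp (φ b)).sum
        - p * (T.map fun b => aeval (φ b) g).sum := by
      rw [herr, ← Multiset.sum_map_mul_left, ← Multiset.sum_map_mul_left, ← Multiset.sum_map_sub]
      simp
    push_cast
    rw [e1, ← hN']
    linear_combination (l : ℂ) ^ (p * D) * n * hsum
  have herrle : ‖err‖ ≤ T.card * (c ^ p / (p - 1).factorial) := by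
    refine (norm_multiset_sum_le _).trans ?_
    rw [Multiset.map_map, ← nsmul_eq_mul, ← Multiset.card_map
      (norm ∘ fun b => n • Complex.exp (φ b) - p • aeval (φ b) g) T]
    refine Multiset.sum_le_card_nsmul _ _ fun x hx => ?_
    obtain ⟨b, hb, rfl⟩ := Multiset.mem_map.mp hx
    refine hgr ?_
    rw [mem_aroots]
    refine ⟨hfne, ?_⟩
    rw [show aeval (φ b) f = φ (aeval b f) from aeval_algHom_apply φ.toIntAlgHom b f, hfT b hb,
      map_zero]
  have hZ : l ^ (p * D) * n * k + p * N = 0 := by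
    rw [← Int.abs_lt_one_iff, ← Int.cast_lt (R := ℝ), Int.cast_abs, Int.cast_one,
      ← Complex.norm_intCast, hid, norm_neg, norm_mul, norm_pow, Complex.norm_intCast]
    refine lt_of_le_of_lt ?_ hp
    calc |(l : ℝ)| ^ (p * D) * ‖err‖
        ≤ |(l : ℝ)| ^ (p * D) * (T.card * (c ^ p / (p - 1).factorial)) := by gcongr
      _ = _ := by rw [mul_pow, ← pow_mul, mul_comm D p]; ring
  have hdvd : (p : ℤ) ∣ l ^ (p * D) * n * k := ⟨-N, by linear_combination hZ⟩
  have hpp : Prime (p : ℤ) := Nat.prime_iff_prime_int.mp hprime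
  have small : ∀ z : ℤ, z ≠ 0 → z.natAbs < p → ¬ (p : ℤ) ∣ z := fun z hz hzp hd =>
    absurd (Nat.le_of_dvd (Int.natAbs_pos.mpr hz) (Int.natCast_dvd.mp hd)) hzp.not_ge
  rcases hpp.dvd_or_dvd hdvd with h | h
  · rcases hpp.dvd_or_dvd h with h | h
    · exact small l hlne hpl (hpp.dvd_of_dvd_pow h)
    · exact hn h
  · exact small k hk hpk h

-- If exp z = −1, the product of 1 + exp(a) over the conjugates a of z vanishes. Expanded, it is a
-- sum of exponentials of subset sums; the zero subset sums (the empty one at least) contribute a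
-- positive integer, and the others form a Galois stable multiset.
open Polynomial in
theorem exp_ne_neg_one_of_isAlgebraic_of_algHom {K : Type*} [Field K] [CharZero K] [Algebra ℚ K]
    [IsGalois ℚ K] [IsAlgClosed K] (φ : K →ₐ[ℚ] ℂ) {z : ℂ} (hz : IsAlgebraic ℚ z) :
    Complex.exp z ≠ -1 := by
  intro hexp
  set m := minpoly ℚ z with hm
  have hm0 : m ≠ 0 := minpoly.ne_zero hz.isIntegral
  have hzr : z ∈ m.rootSet ℂ := (mem_rootSet_of_ne hm0).mpr (minpoly.aeval ℚ z)
  obtain ⟨x, hx, hxz⟩ : ∃ x ∈ m.rootSet K, φ x = z := by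
    have := Splits.image_rootSet (IsAlgClosed.splits (m.map (algebraMap ℚ K))) φ
    rw [← this] at hzr
    exact hzr
  classical
  let s : Finset K := (m.aroots K).toFinset
  have hxs : x ∈ s := by
    rw [Multiset.mem_toFinset, mem_aroots]
    exact ⟨hm0, (mem_rootSet_of_ne hm0).mp hx⟩
  have hsσ : ∀ σ : K ≃ₐ[ℚ] K, s.map σ.toEquiv.toEmbedding = s := by
    intro σ
    refine Finset.eq_of_subset_of_card_le (fun y hy => ?_) (by simp)
    obtain ⟨w, hw, rfl⟩ := Finset.mem_map.mp hy
    rw [Multiset.mem_toFinset, mem_aroots] at hw ⊢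
    refine ⟨hm0, ?_⟩
    rw [show aeval (σ.toEquiv.toEmbedding w) m = σ (aeval w m) from
      aeval_algHom_apply σ.toAlgHom w m, hw.2, map_zero]
  let U : Multiset K := s.powerset.val.map fun t => ∑ a ∈ t, a
  have hUσ : ∀ σ : K ≃ₐ[ℚ] K, U.map σ = U := by
    intro σ
    have : s.powerset.map (Finset.mapEmbedding σ.toEquiv.toEmbedding).toEmbedding = s.powerset := by
      refine Finset.eq_of_subset_of_card_le (fun y hy => ?_) (by simp)
      obtain ⟨w, hw, rfl⟩ := Finset.mem_map.mp hy
      rw [Finset.mem_powerset] at hw ⊢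
      conv_rhs => rw [← hsσ σ]
      exact Finset.map_subset_map.mpr hw
    conv_rhs => simp only [U]; rw [← this]
    simp only [U]
    rw [Multiset.map_map, Finset.map_val, Multiset.map_map]
    refine Multiset.map_congr rfl fun t _ => ?_
    simp [Finset.mapEmbedding_apply]
  let T := U.filter (· ≠ 0)
  have hTσ : ∀ σ : K ≃ₐ[ℚ] K, T.map σ = T := by
    intro σ
    conv_rhs => simp only [T]; rw [← hUσ σ, Multiset.filter_map]
    simp only [T]
    congr 1
    refine Multiset.filter_congr fun y _ => ?_
    simp
  have hprod : ∏ a ∈ s, (1 + Complex.exp (φ a)) = 0 :=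
    Finset.prod_eq_zero hxs (by rw [hxz, hexp]; ring)
  have hUsum : (U.map fun b => Complex.exp (φ b)).sum = 0 := by
    rw [← hprod, Finset.prod_one_add]
    simp only [U]
    rw [Multiset.map_map, Finset.sum_eq_multiset_sum]
    congr 1
    refine Multiset.map_congr rfl fun t _ => ?_
    simp [Complex.exp_sum]
  have hcount : (U.count 0 : ℤ) ≠ 0 := by
    have : (0 : K) ∈ U := Multiset.mem_map.mpr ⟨∅, by simp, by simp⟩
    exact_mod_cast (Multiset.count_pos.mpr this).ne'
  refine intCast_add_sum_exp_ne_zero (φ : K →+* ℂ) hTσ (by simp [T]) hcount ?_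
  have hzero : U.filter (¬ · ≠ 0) = Multiset.replicate (U.count 0) 0 := by
    rw [← Multiset.filter_eq']
    exact Multiset.filter_congr (by simp)
  rw [← hUsum]
  conv_rhs => rw [← Multiset.filter_add_not (· ≠ 0) U]
  rw [Multiset.map_add, Multiset.sum_add, add_comm]
  congr 1
  rw [hzero, Multiset.map_replicate]
  simp

theorem exp_ne_neg_one_of_isAlgebraic {z : ℂ} (hz : IsAlgebraic ℚ z) : Complex.exp z ≠ -1 :=
  have : IsAlgClosed (algebraicClosure ℚ ℂ) :=
    (algebraicClosure.isAlgClosure ℚ ℂ).isAlgClosed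
  exp_ne_neg_one_of_isAlgebraic_of_algHom (algebraicClosure ℚ ℂ).val hz

theorem transcendental_pi : Transcendental ℚ (Real.pi : ℂ) := by
  intro h
  have hI : IsAlgebraic ℚ Complex.I :=
    ⟨Polynomial.X ^ 2 + 1, by
      intro h0
      have := congrArg (Polynomial.eval 0) h0
      simp at this, by simp⟩
  exact exp_ne_neg_one_of_isAlgebraic (h.mul hI) Complex.exp_pi_mul_I

/-! ### Independence of the elementary symmetric values -/

/-- The value at `1, 1/2, …, 1/m` of the elementary symmetric polynomial of degree `j`. -/
def esymmInv : ℕ → ℕ → ℚ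
  | 0, 0 => 1
  | 0, _ + 1 => 0
  | _ + 1, 0 => 1
  | m + 1, j + 1 => esymmInv m (j + 1) + esymmInv m j / (m + 1)

theorem esymmInv_zero_right (m : ℕ) : esymmInv m 0 = 1 := by cases m <;> rfl

theorem esymmInv_succ_succ (m j : ℕ) :
    esymmInv (m + 1) (j + 1) = esymmInv m (j + 1) + esymmInv m j / (m + 1) := rfl

-- Differencing in m acts like a derivative: it removes `c 0` and shifts the remaining coefficients,
-- up to the positive factor 1/(m+1).
open Finset in
theorem sum_mul_esymmInv_succ_sub (n : ℕ) (c : ℕ → ℚ) (m : ℕ) :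
    ∑ j ∈ range (n + 1), c j * esymmInv (m + 1) j - ∑ j ∈ range (n + 1), c j * esymmInv m j =
      (∑ j ∈ range n, c (j + 1) * esymmInv m j) / (m + 1) := by
  rw [sum_range_succ', sum_range_succ', sum_div, add_sub_add_comm, ← sum_sub_distrib]
  simp only [esymmInv_zero_right, sub_self, add_zero, esymmInv_succ_succ]
  exact sum_congr rfl fun j _ => by ring

/-- A discrete Rolle theorem. -/
theorem exists_pos_of_sub_nonneg {F G : ℕ → ℚ} (hFG : ∀ m, F (m + 1) - F m = G m / (m + 1))
    {a b : ℕ} (hab : a < b) (h : F a ≤ F b) : ∃ x, a ≤ x ∧ x < b ∧ 0 ≤ G x := by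
  by_contra! hG
  refine h.not_gt ?_
  induction b, hab using Nat.le_induction with
  | base =>
    have := hFG a
    have h1 : G a / (a + 1) < 0 := div_neg_of_neg_of_pos (hG a le_rfl (by omega)) (by positivity)
    linarith
  | succ b hb ih =>
    have := hFG b
    have h1 : G b / (b + 1) < 0 :=
      div_neg_of_neg_of_pos (hG b (by omega) (by omega)) (by positivity)
    by_cases h2 : F a ≤ F b
    · exact absurd (ih h2 fun x hx hxb => hG x hx (by omega)) (not_lt.mpr h2)
    · linarith

open Finset in
/-- An alternation criterion for the sign of the leading coefficient. -/
theorem leadingCoeff_nonneg_of_alternating (n : ℕ) (c : ℕ → ℚ) (x : ℕ → ℕ) (hx : StrictMono x)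
    (h : ∀ i ≤ n, 0 ≤ (-1) ^ (n + i) * ∑ j ∈ range (n + 1), c j * esymmInv (x i) j) :
    0 ≤ c n := by
  induction n generalizing c x with
  | zero => simpa [esymmInv_zero_right] using h 0 le_rfl
  | succ n ih =>
    -- Between consecutive alternation points the differenced sum takes the required sign; the
    -- half-open intervals keep the new points strictly increasing. Indices i > n only serve to make
    -- `y` total.
    have key : ∀ i, ∃ y, x i ≤ y ∧ y < x (i + 1) ∧
        (i ≤ n → 0 ≤ (-1) ^ (n + i) * ∑ j ∈ range (n + 1), c (j + 1) * esymmInv y j) := by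
      intro i
      by_cases hi : i ≤ n
      · have h1 := h i (by omega)
        have h2 := h (i + 1) (by omega)
        obtain ⟨y, hy1, hy2, hy3⟩ := exists_pos_of_sub_nonneg
          (F := fun m => (-1) ^ (n + i) * ∑ j ∈ range (n + 1 + 1), c j * esymmInv m j)
          (G := fun m => (-1) ^ (n + i) * ∑ j ∈ range (n + 1), c (j + 1) * esymmInv m j)
          (fun m => by rw [← mul_sub, sum_mul_esymmInv_succ_sub, mul_div_assoc])
          (hx (Nat.lt_succ_self i)) (by
            have e1 : (-1 : ℚ) ^ (n + 1 + i) = -(-1) ^ (n + i) := by ring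
            have e2 : (-1 : ℚ) ^ (n + 1 + (i + 1)) = (-1) ^ (n + i) := by ring
            rw [e1] at h1
            rw [e2] at h2
            linarith)
        exact ⟨y, hy1, hy2, fun _ => hy3⟩
      · exact ⟨x i, le_rfl, hx (Nat.lt_succ_self i), fun h => absurd h hi⟩
    choose y hy1 hy2 hy3 using key
    exact ih (fun j => c (j + 1)) y
      (strictMono_nat_of_lt_succ fun i => (hy2 i).trans_le (hy1 (i + 1))) hy3

-- Vanishing satisfies the alternation criterion for both c and −c, which kills the top coefficient;
-- then descend.
open Finset in
theorem coeff_eq_zero_of_sum_mul_esymmInv_eq_zero (n : ℕ) (c : ℕ → ℚ) (x : ℕ → ℕ)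
    (hx : StrictMono x) (h : ∀ i < n, ∑ j ∈ range n, c j * esymmInv (x i) j = 0) :
    ∀ j < n, c j = 0 := by
  induction n with
  | zero => intro j hj; omega
  | succ n ih =>
    have hn : c n = 0 := by
      refine le_antisymm ?_ ?_
      · have := leadingCoeff_nonneg_of_alternating n (fun j => -c j) x hx fun i hi => by
          simp [h i (by omega)]
        linarith
      · exact leadingCoeff_nonneg_of_alternating n c x hx fun i hi => by
          simp [h i (by omega)]
    intro j hj
    rcases Nat.lt_succ_iff_lt_or_eq.mp hj with hj | rfl
    · refine ih (fun i hi => ?_) j hj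
      have := h i (by omega)
      rwa [sum_range_succ, hn, zero_mul, add_zero] at this
    · exact hn

/-- A strictly increasing map on `Fin n` extends to one on `ℕ`. -/
theorem exists_strictMono_extend {n : ℕ} (x : Fin n → ℕ) (hx : StrictMono x) :
    ∃ y : ℕ → ℕ, StrictMono y ∧ ∀ i : Fin n, y i = x i := by
  let B := Finset.univ.sup x
  refine ⟨fun i => if h : i < n then x ⟨i, h⟩ else B + 1 + i, ?_, fun i => by simp⟩
  intro i j hij
  have hB : ∀ i, x i ≤ B := fun i => Finset.le_sup (Finset.mem_univ i)
  by_cases hj : j < n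
  · simp only [hj, hij.trans hj, dite_true]
    exact hx hij
  · by_cases hi : i < n
    · simp only [hj, hi, dite_true, dite_false]
      have := hB ⟨i, hi⟩
      omega
    · simp only [hj, hi, dite_false]
      omega

theorem isUnit_det_esymmInv {n : ℕ} (x : Fin n → ℕ) (hx : StrictMono x) :
    IsUnit (Matrix.of fun i j : Fin n => esymmInv (x i) j).det := by
  rw [isUnit_iff_ne_zero]
  intro hdet
  obtain ⟨v, hv, hv0⟩ := Matrix.exists_mulVec_eq_zero_iff.mpr hdet
  obtain ⟨y, hy, hyx⟩ := exists_strictMono_extend x hx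
  have := coeff_eq_zero_of_sum_mul_esymmInv_eq_zero n
    (fun j => if h : j < n then v ⟨j, h⟩ else 0) y hy fun i hi => by
      have := congrFun hv0 ⟨i, hi⟩
      rw [Finset.sum_range, hyx ⟨i, hi⟩]
      simpa [Matrix.mulVec, dotProduct, mul_comm] using this
  refine hv (funext fun j => ?_)
  simpa using this j j.2

/-- If a linear system with invertible rational matrix has algebraic right-hand side, then its
solutions are algebraic. -/
theorem isAlgebraic_of_rat_mulVec {n : ℕ} {A : Matrix (Fin n) (Fin n) ℚ} (hA : IsUnit A.det)
    (v : Fin n → ℂ) (h : ∀ i, IsAlgebraic ℚ (∑ j, (A i j : ℂ) * v j)) (j : Fin n) :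
    IsAlgebraic ℚ (v j) := by
  have e : v j = ∑ i, ((A⁻¹ j i : ℚ) : ℂ) * ∑ k, (A i k : ℂ) * v k := by
    have h1 : ∀ k, ∑ i, ((A⁻¹ j i : ℚ) : ℂ) * (A i k : ℂ) = if j = k then 1 else 0 := by
      intro k
      have := congrFun (congrFun (Matrix.nonsing_inv_mul A hA) j) k
      rw [Matrix.mul_apply, Matrix.one_apply] at this
      have h2 := congrArg (fun q : ℚ => (q : ℂ)) this
      rw [apply_ite (Rat.cast (K := ℂ))] at h2
      push_cast at h2
      exact h2
    simp_rw [Finset.mul_sum]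
    rw [Finset.sum_comm]
    simp_rw [← mul_assoc, ← Finset.sum_mul, h1]
    simp
  rw [e]
  have hsum : ∀ (s : Finset (Fin n)) (f : Fin n → ℂ), (∀ i, IsAlgebraic ℚ (f i)) →
      IsAlgebraic ℚ (∑ i ∈ s, f i) := fun s f hf =>
    (Subalgebra.sum_mem (Subalgebra.algebraicClosure ℚ ℂ) fun i _ => hf i)
  exact hsum _ _ fun i => (isAlgebraic_algebraMap (A⁻¹ j i)).mul (h i)

/-! ### Taylor coefficients of Γ at positive integers -/

open Complex in
theorem contDiffAt_Gamma {s : ℂ} (hs : 0 < s.re) (n : WithTop ℕ∞) : ContDiffAt ℂ n Gamma s := by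
  have hopen : IsOpen {s : ℂ | 0 < s.re} := isOpen_lt continuous_const continuous_re
  have hd : DifferentiableOn ℂ Gamma {s : ℂ | 0 < s.re} := fun z hz =>
    (differentiableAt_Gamma z fun m h => by
      have : (0 : ℝ) < z.re := hz
      rw [h, neg_re, natCast_re] at this
      have := m.cast_nonneg (α := ℝ)
      linarith).differentiableWithinAt
  exact (hd.analyticAt (hopen.mem_nhds hs)).contDiffAt

open Complex Filter Topology in
theorem iteratedDeriv_Gamma_add_one {s : ℂ} (hs : 0 < s.re) (n : ℕ) :
    iteratedDeriv (n + 1) Gamma (s + 1) =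
      s * iteratedDeriv (n + 1) Gamma s + (n + 1) * iteratedDeriv n Gamma s := by
  have hev : (fun z => Gamma (z + 1)) =ᶠ[𝓝 s] fun z => z * Gamma z := by
    filter_upwards [(isOpen_lt continuous_const continuous_re).mem_nhds hs] with z hz
    refine Gamma_add_one z fun h => ?_
    simp [h] at hz
  have h1 := hev.iteratedDeriv_eq (n + 1)
  rw [iteratedDeriv_comp_add_const] at h1
  refine h1.trans ?_
  rw [iteratedDeriv_fun_mul (f := fun z => z) contDiffAt_id (contDiffAt_Gamma hs _),
    Finset.sum_range_succ', Finset.sum_range_succ']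
  simp [iteratedDeriv_fun_id]
  ring

open Complex in
/-- The `n`-th Taylor coefficient of the Gamma function at `m + 1`, divided by `m!`. -/
noncomputable def normalizedTaylorCoeff (m n : ℕ) : ℂ :=
  iteratedDeriv n Gamma (m + 1) / (n.factorial * m.factorial)

open Complex in
theorem normalizedTaylorCoeff_zero_right (m : ℕ) : normalizedTaylorCoeff m 0 = 1 := by
  simp [normalizedTaylorCoeff, Gamma_nat_eq_factorial, m.factorial_ne_zero]

theorem normalizedTaylorCoeff_succ_succ (m n : ℕ) : normalizedTaylorCoeff (m + 1) (n + 1) =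
    normalizedTaylorCoeff m (n + 1) + normalizedTaylorCoeff m n / (m + 1) := by
  have h := iteratedDeriv_Gamma_add_one (s := m + 1) (by simp; positivity) n
  have hm : (m.factorial : ℂ) ≠ 0 := by exact_mod_cast m.factorial_ne_zero
  have hn : (n.factorial : ℂ) ≠ 0 := by exact_mod_cast n.factorial_ne_zero
  have hm1 : (m + 1 : ℂ) ≠ 0 := by exact_mod_cast m.succ_ne_zero
  have hn1 : (n + 1 : ℂ) ≠ 0 := by exact_mod_cast n.succ_ne_zero
  simp only [normalizedTaylorCoeff, Nat.factorial_succ]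
  push_cast
  rw [h]
  field_simp

-- This is the coefficient of s^n in Γ(m+1+s)/m! = Γ(1+s)·∏_{k≤m}(1+s/k).
open Finset in
theorem normalizedTaylorCoeff_eq_sum (m n : ℕ) : normalizedTaylorCoeff m n =
    ∑ j ∈ range (n + 1), (esymmInv m j : ℂ) * normalizedTaylorCoeff 0 (n - j) := by
  induction m generalizing n with
  | zero =>
    rw [sum_range_succ']
    simp [esymmInv]
  | succ m ih =>
    cases n with
    | zero => simp [normalizedTaylorCoeff_zero_right, esymmInv_zero_right]
    | succ n =>
      rw [normalizedTaylorCoeff_succ_succ, ih, ih, sum_range_succ' _ (n + 1),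
        sum_range_succ' _ (n + 1)]
      simp only [esymmInv_succ_succ, esymmInv_zero_right, sum_div, Nat.add_sub_add_right]
      rw [add_right_comm, ← sum_add_distrib]
      congr 1
      refine sum_congr rfl fun j _ => ?_
      push_cast
      ring

/-! ### The relation with π² -/

open Complex Filter Topology in
/-- The reflection formula in a form regular at the origin. -/
theorem Gamma_one_add_mul_Gamma_one_sub_mul_sin :
    (fun s : ℂ => Gamma (1 + s) * Gamma (1 - s) * sin (Real.pi * s)) =ᶠ[𝓝 0]
      fun s => Real.pi * s := by
  have h : ∀ᶠ s : ℂ in 𝓝 0, ‖s‖ < 1 := by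
    filter_upwards [Metric.ball_mem_nhds (0 : ℂ) one_pos] with s hs using mem_ball_zero_iff.mp hs
  filter_upwards [h] with s hs
  rcases eq_or_ne s 0 with rfl | h0
  · simp
  have hsin : sin (Real.pi * s) ≠ 0 := by
    rw [Ne, sin_eq_zero_iff]
    rintro ⟨k, hk⟩
    have hk' : s = k := by
      have : (Real.pi : ℂ) ≠ 0 := ofReal_ne_zero.mpr Real.pi_ne_zero
      exact mul_left_cancel₀ this (by rw [hk]; ring)
    rw [hk', norm_intCast] at hs
    have : k = 0 := Int.abs_lt_one_iff.mp (by exact_mod_cast hs)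
    exact h0 (by rw [hk', this, Int.cast_zero])
  rw [add_comm, Gamma_add_one s h0, mul_assoc s, Gamma_mul_Gamma_one_sub, mul_assoc,
    div_mul_cancel₀ _ hsin, mul_comm]

-- Compare third derivatives at 0 in the regular form of the reflection formula: the right side is
-- linear and drops out, and one factor π cancels.
open Complex Filter Topology in
theorem iteratedDeriv_two_Gamma_one :
    iteratedDeriv 2 Gamma 1 - iteratedDeriv 1 Gamma 1 ^ 2 = (Real.pi : ℂ) ^ 2 / 6 := by
  have hpi : (Real.pi : ℂ) ≠ 0 := ofReal_ne_zero.mpr Real.pi_ne_zero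
  have hG : ∀ n : ℕ, ContDiffAt ℂ n Gamma 1 := fun n => contDiffAt_Gamma (by simp) n
  have hA : ∀ n : ℕ, ContDiffAt ℂ n (fun s : ℂ => Gamma (1 + s)) 0 := fun n =>
    ContDiffAt.comp (g := Gamma) 0 (by simpa using hG n) (by fun_prop)
  have hB : ∀ n : ℕ, ContDiffAt ℂ n (fun s : ℂ => Gamma (1 - s)) 0 := fun n =>
    ContDiffAt.comp (g := Gamma) 0 (by simpa using hG n) (by fun_prop)
  have dA : ∀ n : ℕ, iteratedDeriv n (fun s : ℂ => Gamma (1 + s)) 0 = iteratedDeriv n Gamma 1 :=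
    fun n => by rw [iteratedDeriv_comp_const_add]; simp
  have dB : ∀ n : ℕ, iteratedDeriv n (fun s : ℂ => Gamma (1 - s)) 0 =
      (-1) ^ n * iteratedDeriv n Gamma 1 :=
    fun n => by rw [iteratedDeriv_comp_const_sub]; simp
  have dS : ∀ n : ℕ, iteratedDeriv n (fun s : ℂ => sin (Real.pi * s)) 0 =
      Real.pi ^ n * iteratedDeriv n sin 0 := fun n => by
    rw [iteratedDeriv_comp_const_mul (contDiff_sin)]; simp
  have hS : ∀ n : ℕ, ContDiffAt ℂ n (fun s : ℂ => sin (Real.pi * s)) 0 := fun n => by fun_prop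
  have s0 : iteratedDeriv 0 sin (0 : ℂ) = 0 := by simp
  have s1 : iteratedDeriv 1 sin (0 : ℂ) = 1 := by simp [iteratedDeriv_one]
  have s2 : iteratedDeriv 2 sin (0 : ℂ) = 0 := by simp [iteratedDeriv_succ]
  have s3 : iteratedDeriv 3 sin (0 : ℂ) = -1 := by simp [iteratedDeriv_succ]
  have hlin : iteratedDeriv 3 (fun s : ℂ => (Real.pi : ℂ) * s) 0 = 0 := by
    rw [iteratedDeriv_const_mul_field, iteratedDeriv_fun_id]; simp
  have hAB : ∀ n : ℕ, iteratedDeriv n (fun s : ℂ => Gamma (1 + s) * Gamma (1 - s)) 0 =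
      ∑ i ∈ Finset.range (n + 1), n.choose i * iteratedDeriv i Gamma 1 *
        ((-1) ^ (n - i) * iteratedDeriv (n - i) Gamma 1) := fun n => by
    rw [iteratedDeriv_fun_mul (hA n) (hB n)]
    simp only [dA, dB]
  have h := Gamma_one_add_mul_Gamma_one_sub_mul_sin.iteratedDeriv_eq 3
  rw [hlin, iteratedDeriv_fun_mul ((hA 3).mul (hB 3)) (hS 3)] at h
  simp only [Finset.sum_range_succ, Finset.sum_range_zero, dS, hAB, s0, s1, s2, s3, Nat.sub_self,
    Nat.reduceSub, Nat.choose_self, Nat.choose_zero_right, Nat.choose_one_right,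
    show Nat.choose 3 2 = 3 from rfl, iteratedDeriv_zero, Gamma_one] at h
  have h2 : (Real.pi : ℂ) * (6 * (iteratedDeriv 2 Gamma 1 - iteratedDeriv 1 Gamma 1 ^ 2) -
      (Real.pi : ℂ) ^ 2) = 0 := by
    push_cast at h
    linear_combination h
  rcases mul_eq_zero.mp h2 with h3 | h3
  · exact absurd h3 hpi
  · linear_combination h3 / 6

/-- The first two normalized Taylor coefficients of the Gamma function at `1` are not both
algebraic. -/
theorem not_isAlgebraic_normalizedTaylorCoeff
    (h1 : IsAlgebraic ℚ (normalizedTaylorCoeff 0 1))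
    (h2 : IsAlgebraic ℚ (normalizedTaylorCoeff 0 2)) : False := by
  refine transcendental_pi (IsAlgebraic.of_pow (n := 2) two_pos ?_)
  have e : (Real.pi : ℂ) ^ 2 = ((12 : ℕ) : ℂ) * normalizedTaylorCoeff 0 2 -
      ((6 : ℕ) : ℂ) * normalizedTaylorCoeff 0 1 ^ 2 := by
    have := iteratedDeriv_two_Gamma_one
    simp only [normalizedTaylorCoeff, Nat.cast_zero, zero_add, Nat.factorial]
    push_cast
    linear_combination (-6) * this
  rw [e]
  exact ((isAlgebraic_natCast 12).mul h2).sub ((isAlgebraic_natCast 6).mul (h1.pow 2))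

/-! ### Conclusion -/

theorem isAlgebraic_normalizedTaylorCoeff_iff {m n : ℕ} :
    IsAlgebraic ℚ (normalizedTaylorCoeff m n) ↔
      IsAlgebraic ℚ (iteratedDeriv n Complex.Gamma ((m + 1 : ℕ) : ℂ)) := by
  have hm : (m.factorial : ℂ) ≠ 0 := by exact_mod_cast m.factorial_ne_zero
  have hn : (n.factorial : ℂ) ≠ 0 := by exact_mod_cast n.factorial_ne_zero
  have hc : IsAlgebraic ℚ ((n.factorial * m.factorial : ℂ)) :=
    (isAlgebraic_natCast _).mul (isAlgebraic_natCast _)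
  have e : iteratedDeriv n Complex.Gamma ((m + 1 : ℕ) : ℂ) =
      normalizedTaylorCoeff m n * (n.factorial * m.factorial) := by
    rw [normalizedTaylorCoeff, div_mul_cancel₀ _ (mul_ne_zero hn hm)]
    push_cast
    rfl
  rw [e]
  refine ⟨fun h => h.mul hc, fun h => ?_⟩
  have := h.mul hc.inv
  rwa [mul_assoc, mul_inv_cancel₀ (mul_ne_zero hn hm), mul_one] at this

theorem not_forall_isAlgebraic_normalizedTaylorCoeff {n : ℕ} (hn : 2 ≤ n) {x : Fin n → ℕ}
    (hx : StrictMono x) (h : ∀ i, IsAlgebraic ℚ (normalizedTaylorCoeff (x i) n)) : False := by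
  have hv := isAlgebraic_of_rat_mulVec (isUnit_det_esymmInv x hx)
    (fun j => normalizedTaylorCoeff 0 (n - j)) fun i => by
      -- The term j = n is rational because γ_0 = 1; moving it across leaves a square system in γ_n,
      -- …, γ_1.
      have e : ∑ j : Fin n, ((Matrix.of fun i j : Fin n => esymmInv (x i) j) i j : ℂ) *
          normalizedTaylorCoeff 0 (n - j) =
          normalizedTaylorCoeff (x i) n - algebraMap ℚ ℂ (esymmInv (x i) n) := by
        rw [normalizedTaylorCoeff_eq_sum, Finset.sum_range_succ, Finset.sum_range]
        simp [normalizedTaylorCoeff_zero_right]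
      rw [e]
      exact (h i).sub (isAlgebraic_algebraMap _)
  refine not_isAlgebraic_normalizedTaylorCoeff ?_ ?_
  -- The unknown in column j is γ_{n−j}, so γ_1 and γ_2 sit in columns n − 1 and n − 2.
  · simpa [Nat.sub_sub_self (show 1 ≤ n by omega)] using hv ⟨n - 1, by omega⟩
  · simpa [Nat.sub_sub_self hn] using hv ⟨n - 2, by omega⟩

theorem theorem1 (n : ℕ) (hn : 2 ≤ n) :
    {m : ℕ | 1 ≤ m ∧ IsAlgebraic ℚ (iteratedDeriv n Complex.Gamma (m : ℂ))}.encard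
      ≤ ((n - 1 : ℕ) : ℕ∞) := by
  by_contra! hlt
  have hle : (n : ℕ∞) ≤
      {m : ℕ | 1 ≤ m ∧ IsAlgebraic ℚ (iteratedDeriv n Complex.Gamma (m : ℂ))}.encard := by
    have := Order.add_one_le_of_lt hlt
    rwa [show ((n - 1 : ℕ) : ℕ∞) + 1 = n by exact_mod_cast Nat.sub_add_cancel (by omega)] at this
  obtain ⟨t, ht, htn⟩ := Set.exists_subset_encard_eq hle
  have htfin : t.Finite := Set.finite_of_encard_eq_coe htn
  obtain ⟨s, rfl⟩ := htfin.exists_finset_coe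
  rw [Set.encard_coe_eq_coe_finsetCard, Nat.cast_inj] at htn
  have hmem : ∀ i, s.orderEmbOfFin htn i ∈ s := s.orderEmbOfFin_mem htn
  have hpos : ∀ i, 1 ≤ s.orderEmbOfFin htn i := fun i => (ht (hmem i)).1
  refine not_forall_isAlgebraic_normalizedTaylorCoeff hn
    (x := fun i => s.orderEmbOfFin htn i - 1) (fun i j hij => ?_) fun i => ?_
  · have := (s.orderEmbOfFin htn).strictMono hij
    have := hpos i
    simp only
    omega
  · rw [isAlgebraic_normalizedTaylorCoeff_iff, Nat.sub_add_cancel (hpos i)]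
    exact (ht (hmem i)).2
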